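/- Let $H$ and $G_1,\dots,G_m$ be real Hilbert spaces. Let $f:H\to\mathbb R$ be convex and differentiable with $L$-Lipschitz continuous gradient, $L\in(0,\infty)$; let $g\in\Gamma_0(H)$ and $h_i\in\Gamma_0(G_i)$, where $\Gamma_0(E)$ is the set of proper lower semicontinuous convex functions $E\to(-\infty,+\infty]$; and let $B_i:H\to G_i$ be bounded linear operators. Assume that the optimality system $$0\in\nabla f(x)+\partial g(x)+\sum_{i=1}^m B_i^*\,\partial h_i(B_ix)$$ has at least one solution $x\in H$. Let $w_1,\dots,w_m>0$ with $\sum_{i=1}^m w_i=1$ (so $w_i\in(0,1)$ if $m\ge 2$), let $\gamma\in(0,2/L)$, and let $\lambda>0$ satisfy $\lambda\sum_{i=1}^m w_i\|B_i\|^2<1$. Write $\varphi^*(y)=\sup_x\{\langle x,y\rangle-\varphi(x)\}$ and $\mathrm{prox}_{c\varphi}(u)=\arg\min_x\{\tfrac12\|x-u\|^2+c\,\varphi(x)\}$. For arbitrary $x^0\in H$ and $\mathbf y^0=(y_1^0,\dots,y_m^0)\in\mathbf G=G_1\times\cdots\times G_m$, let the sequences be generated by the dual forward-backward splitting algorithm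 with a single inner iteration: for $k=0,1,2,\dots$ and $i=1,\dots,m$, $$u^k=x^k-\gamma\nabla f(x^k),$$ $$y_i^{k+1}=\frac1{w_i}\,\mathrm{prox}_{w_i\frac{\lambda}{\gamma}h_i^*}\Big(w_i\Big(y_i^k+\frac{\lambda}{\gamma}B_i\,\mathrm{prox}_{\gamma g}\Big(u^k-\gamma\sum_{j=1}^m w_jB_j^*y_j^k\Big)\Big)\Big),$$ $$x^{k+1}=\mathrm{prox}_{\gamma g}\Big(u^k-\gamma\sum_{j=1}^m w_jB_j^*y_j^{k+1}\Big).$$ Then $(x^k,\mathbf y^k)$ is a sequence of the primal-dual fixed point (PDFP) scheme for $f(x)+g(x)+\mathbf h(\mathbf Bx)$, where $\mathbf B x=(B_1x,\dots,B_mx)$, $\mathbf h(\mathbf y)=\sum_{i=1}^m h_i(y_i)$ and $\mathbf G$ carries the inner product $\langle\mathbf y,\mathbf z\rangle_{1,\mathbf G}=\sum_{i=1}^m w_i\langle y_i,z_i\rangle$; that is, with adjoint, conjugate and proximity operator on $\mathbf G$ taken with respect to $\langle\cdot,\cdot\rangle_{1,\mathbf G}$, there are $v^k\in H$ such that for all $k\ge0$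 $$v^k=\mathrm{prox}_{\gamma g}(x^k-\gamma\nabla f(x^k)-\gamma\mathbf B^*\mathbf y^k),\quad \mathbf y^{k+1}=\mathrm{prox}_{\frac{\lambda}{\gamma}\mathbf h^*}\Big(\mathbf y^k+\frac{\lambda}{\gamma}\mathbf Bv^k\Big),\quad x^{k+1}=\mathrm{prox}_{\gamma g}(x^k-\gamma\nabla f(x^k)-\gamma\mathbf B^*\mathbf y^{k+1}).$$ Moreover, $x^k$ converges weakly in $H$ to a minimizer of $x\mapsto f(x)+g(x)+\sum_{i=1}^m h_i(B_ix)$. -/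

import Mathlib

open Filter Topology
open scoped NNReal

noncomputable section

namespace CompositeSplitting

/-- `φ ∈ Γ₀(E)`: a proper, lower semicontinuous, convex function `E → (-∞, +∞]`. -/
structure Gamma0 {E : Type*} [NormedAddCommGroup E] [NormedSpace ℝ E] (φ : E → EReal) : Prop where
  ne_bot : ∀ x, φ x ≠ ⊥
  exists_ne_top : ∃ x, φ x ≠ ⊤
  lsc : LowerSemicontinuous φ
  convex : ∀ x y : E, ∀ a b : ℝ, 0 < a → 0 < b → a + b = 1 →
    φ (a • x + b • y) ≤ (a : EReal) * φ x + (b : EReal) * φ y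

/-- The Fenchel conjugate of `φ` with respect to the inner product `p`:
`φ^*(y) = sup_x (p x y - φ x)`. -/
def conjWith {E : Type*} (p : E → E → ℝ) (φ : E → EReal) (y : E) : EReal :=
  ⨆ x : E, ((p x y : ℝ) : EReal) - φ x

/-- `x` minimizes `z ↦ (1/2) ‖z - u‖² + c φ(z)`, where the norm is the one of the inner
product `p`. -/
def IsProxWith {E : Type*} [AddCommGroup E] (p : E → E → ℝ) (φ : E → EReal) (c : ℝ)
    (u x : E) : Prop :=
  ∀ z : E, ((1 / 2 * p (x - u) (x - u) : ℝ) : EReal) + (c : EReal) * φ x ≤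
    ((1 / 2 * p (z - u) (z - u) : ℝ) : EReal) + (c : EReal) * φ z

/-- The proximity operator `prox_{c φ}` with respect to the inner product `p`: the point
`argmin_z { (1/2) ‖z - u‖² + c φ(z) }`. (The minimizer exists and is unique when `p` is a Hilbert
space inner product, `φ ∈ Γ₀` and `c > 0`.) -/
def proxWith {E : Type*} [AddCommGroup E] (p : E → E → ℝ) (φ : E → EReal) (c : ℝ) (u : E) : E :=
  Classical.epsilon (IsProxWith p φ c u)

section Hilbert

variable {E : Type*} [NormedAddCommGroup E] [InnerProductSpace ℝ E]

/-- The Fenchel conjugate `φ^*` in a Hilbert space. -/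
def conj (φ : E → EReal) : E → EReal :=
  conjWith (fun x y : E => inner ℝ x y) φ

/-- The proximity operator `prox_{c φ}` in a Hilbert space. -/
def prox (φ : E → EReal) (c : ℝ) : E → E :=
  proxWith (fun x y : E => inner ℝ x y) φ c

/-- The convex subdifferential `∂φ(x)`. -/
def subdiff (φ : E → EReal) (x : E) : Set E :=
  {q | ∀ z : E, φ x + ((inner ℝ q (z - x) : ℝ) : EReal) ≤ φ z}

end Hilbert

section Problem

variable {H : Type*} [NormedAddCommGroup H] [InnerProductSpace ℝ H] [CompleteSpace H]
  {m : ℕ} {G : Fin m → Type*} [∀ i, NormedAddCommGroup (G i)] [∀ i, InnerProductSpace ℝ (G i)]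
  [∀ i, CompleteSpace (G i)]

/-- The objective function `f(x) + g(x) + ∑ i, h_i(B_i x)`. -/
def objective (f : H → ℝ) (g : H → EReal) (h : ∀ i, G i → EReal) (B : ∀ i, H →L[ℝ] G i)
    (x : H) : EReal :=
  (f x : EReal) + g x + ∑ i, h i (B i x)

/-- The weighted inner product `∑ i, w_i ⟨y_i, z_i⟩` on `G_1 × ⋯ × G_m`. -/
def weightedInner (w : Fin m → ℝ) (y z : ∀ i, G i) : ℝ :=
  ∑ i, w i * inner ℝ (y i) (z i)

/-- One inner iteration of the dual forward-backward splitting algorithm: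
`y_i ↦ (1/w_i) prox_{w_i (λ/γ) h_i^*}
  (w_i (y_i + (λ/γ) B_i prox_{γ g} (u - γ ∑ j, w_j B_j^* y_j)))`. -/
def innerStep (g : H → EReal) (h : ∀ i, G i → EReal) (B : ∀ i, H →L[ℝ] G i) (w : Fin m → ℝ)
    (γ lam : ℝ) (u : H) (y : ∀ i, G i) : ∀ i, G i := fun i =>
  (1 / w i) • prox (conj (h i)) (w i * (lam / γ))
    (w i • (y i + (lam / γ) •
      B i (prox g γ (u - γ • ∑ j, w j • ContinuousLinearMap.adjoint (B j) (y j)))))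

/-- The sequences `u`, `x`, `y` are generated by the (first class of) dual forward-backward
splitting algorithm from the initial point `(x 0, y 0)`, with `J k` inner iterations in the `k`-th
outer iteration; `y k` is the dual variable at the beginning of the `k`-th outer iteration. -/
structure IsDualFBSequence (f : H → ℝ) (g : H → EReal) (h : ∀ i, G i → EReal)
    (B : ∀ i, H →L[ℝ] G i) (w : Fin m → ℝ) (γ lam : ℝ) (J : ℕ → ℕ)
    (u x : ℕ → H) (y : ℕ → ∀ i, G i) : Prop where
  outer : ∀ k, u k = x k - γ • gradient f (x k)
  inner_loop : ∀ k, y (k + 1) = (innerStep g h B w γ lam (u k))^[J k] (y k)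
  update : ∀ k, x (k + 1) =
    prox g γ (u k - γ • ∑ j, w j • ContinuousLinearMap.adjoint (B j) (y (k + 1) j))

end Problem

/-- `(x, y)` is a sequence of the primal-dual fixed point (PDFP) algorithm for
`f(x) + g(x) + h(A x)`, where `A : H → K`, the space `K` carries the inner product `p` and `A'` is
the adjoint of `A`. -/
def IsPDFPSequence {H K : Type*} [NormedAddCommGroup H] [InnerProductSpace ℝ H] [CompleteSpace H]
    [AddCommGroup K] [Module ℝ K] (p : K → K → ℝ) (f : H → ℝ) (g : H → EReal) (h : K → EReal)
    (A : H → K) (A' : K → H) (γ lam : ℝ) (x : ℕ → H) (y : ℕ → K) : Prop :=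
  ∃ v : ℕ → H, ∀ k,
    v k = prox g γ (x k - γ • gradient f (x k) - γ • A' (y k)) ∧
    y (k + 1) = proxWith p (conjWith p h) (lam / γ) (y k + (lam / γ) • A (v k)) ∧
    x (k + 1) = prox g γ (x k - γ • gradient f (x k) - γ • A' (y (k + 1)))

end CompositeSplitting

end

/-! In the weighted inner product the adjoint of `x ↦ (B_i x)_i` is `∑ w_j B_j^* y_j`, and the
conjugate and prox of a separable function decouple. The scaled proxes of the algorithm are
therefore exactly the PDFP dual step. Both reduce to one inclusion, `B_i v + (γ/λ)(y_i - y_i') ∈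
∂h_i^*(w_i y_i')`.

For convergence, `y_i ↦ √w_i y_i` carries the weighted product to the `ℓ²`-product, where the
iteration is a scheme for two relations `M = ∂g`, `N = ∂h^*` and a cocoercive map `F = ∇f`
(Baillon–Haddad, `inner_gradient_sub_ge`). The estimate `pdfp_step`, with cocoercivity, makes `‖x -
x*‖² + (γ²/λ)‖y - y*‖²` decrease, so the residuals vanish and `F (x k)` converges strongly
(`IsPDFPOrbit.asymptotics`). Weak cluster points are then primal-dual solutions by Minty's argument
(`IsPDFPOrbit.isPrimalDualZero_of_weakTendsto`), and Opial's argument gives a single weak limit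
(`IsPDFPOrbit.exists_weak_limit`). The subgradient inequalities turn a primal-dual solution into a
minimizer.

The assumed solution supplies a subgradient of `g` and of each `h_i`. The resulting affine minorants
give existence of proxes and properness of conjugates without a separation theorem. -/

namespace CompositeSplitting

/-! ### Monotone relations and the one-step estimate -/

section Abstract

variable {H K : Type*} [NormedAddCommGroup H] [InnerProductSpace ℝ H] [CompleteSpace H]
  [NormedAddCommGroup K] [InnerProductSpace ℝ K] [CompleteSpace K]

/-- A bounded family in a Hilbert space converges weakly along every ultrafilter. -/
lemma exists_weak_limit {ι : Type*} (U : Ultrafilter ι) {x : ι → H} {C : ℝ}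
    (hC : ∀ k, ‖x k‖ ≤ C) :
    ∃ a : H, ∀ z : H, Tendsto (fun k => inner ℝ (x k) z) U (𝓝 (inner ℝ a z)) := by
  -- The Riesz isometry turns the claim into weak-* compactness of the dual ball (Banach–Alaoglu).
  let e : ι → WeakDual ℝ H := fun k =>
    StrongDual.toWeakDual (InnerProductSpace.toDual ℝ H (x k))
  have hcomp := WeakDual.isCompact_closedBall (𝕜 := ℝ) (E := H) 0 C
  obtain ⟨b, -, hb⟩ := hcomp.ultrafilter_le_nhds (U.map e) (by
    refine le_principal_iff.2 (Filter.mem_map.2 (Filter.univ_mem' fun k => ?_))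
    simpa [e] using hC k)
  refine ⟨(InnerProductSpace.toDual ℝ H).symm (WeakDual.toStrongDual b), fun z => ?_⟩
  have h1 : Tendsto e U (𝓝 b) := hb
  have h2 := (WeakDual.eval_continuous z).continuousAt.tendsto.comp h1
  rw [InnerProductSpace.toDual_symm_apply]
  exact h2

/-- A relation on a Hilbert space (read as a set-valued operator `p ↦ {q | M p q}`) is monotone. -/
def IsMonotoneRel (M : H → H → Prop) : Prop :=
  ∀ ⦃p q p' q'⦄, M p q → M p' q' → 0 ≤ inner ℝ (p - p') (q - q')

/-- A relation on a Hilbert space is `3`-cyclically monotone. -/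
def IsThreeCyclic (M : H → H → Prop) : Prop :=
  ∀ ⦃p₁ q₁ p₂ q₂ p₃ q₃⦄, M p₁ q₁ → M p₂ q₂ → M p₃ q₃ →
    inner ℝ q₁ (p₂ - p₁) + inner ℝ q₂ (p₃ - p₂) + inner ℝ q₃ (p₁ - p₃) ≤ (0 : ℝ)

/-- The resolvent of the relation is everywhere defined. -/
def HasResolvent (M : H → H → Prop) : Prop :=
  ∀ s, ∃ p, M p (s - p)

omit [CompleteSpace H] in
lemma IsThreeCyclic.isMonotoneRel {M : H → H → Prop} (hM : IsThreeCyclic M) :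
    IsMonotoneRel M := by
  intro p q p' q' h h'
  have := hM h h h'
  simp only [sub_self, inner_zero_right, inner_sub_left, inner_sub_right] at *
  linarith [real_inner_comm p q, real_inner_comm p q', real_inner_comm p' q,
    real_inner_comm p' q']

-- The step evaluates `M` at two points, `v` and `x'`, and the dual inclusion sees only `v`.
-- Three-cyclicity along `v → x' → xs → v` links both to the solution. Changing `y` to `y'` between
-- the two evaluations costs a cross term, which `‖v - x'‖²` and the fraction `θ` of `‖y' - y‖²`
-- absorb. Nothing is assumed about `a` here, so its term is left for cocoercivity.
open ContinuousLinearMap in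
lemma pdfp_step {M : H → H → Prop} {N : K → K → Prop} (hM : IsThreeCyclic M)
    (hN : IsMonotoneRel N) (A : H →L[ℝ] K) {γ lam θ : ℝ} (hγ : 0 < γ) (hlam : 0 < lam)
    (hA : ∀ y, lam * ‖adjoint A y‖ ^ 2 ≤ θ * ‖y‖ ^ 2)
    {x v x' xs a as : H} {y y' ys : K}
    (hv : M v (γ⁻¹ • (x - γ • a - γ • adjoint A y - v)))
    (hx' : M x' (γ⁻¹ • (x - γ • a - γ • adjoint A y' - x')))
    (hy' : N y' (A v + (γ / lam) • (y - y')))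
    (hxs : M xs (-as - adjoint A ys)) (hys : N ys (A xs)) :
    ‖x' - xs‖ ^ 2 + γ ^ 2 / lam * ‖y' - ys‖ ^ 2 + ‖x - v‖ ^ 2
      + γ ^ 2 / lam * (1 - θ) * ‖y' - y‖ ^ 2 ≤
    ‖x - xs‖ ^ 2 + γ ^ 2 / lam * ‖y - ys‖ ^ 2 + 2 * γ * inner ℝ (a - as) (xs - v) := by
  have h3 := hM hv hx' hxs
  have h4 := hN hy' hys
  have h5 : γ ^ 2 * ‖adjoint A (y' - y)‖ ^ 2 ≤ γ ^ 2 / lam * θ * ‖y' - y‖ ^ 2 := by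
    have := mul_le_mul_of_nonneg_left (hA (y' - y)) (by positivity : 0 ≤ γ ^ 2 / lam)
    calc _ = γ ^ 2 / lam * (lam * ‖adjoint A (y' - y)‖ ^ 2) := by field_simp
      _ ≤ _ := by linarith
  have h6 : 0 ≤ ‖γ • adjoint A (y' - y) - (v - x')‖ ^ 2 := sq_nonneg _
  have h3' := mul_le_mul_of_nonneg_left h3 hγ.le
  have h4' := mul_nonneg (by positivity : 0 ≤ γ ^ 2 / lam * (lam / γ)) h4
  obtain ⟨r, hr⟩ : ∃ r, r = γ ^ 2 / lam := ⟨_, rfl⟩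
  have e1 : γ ^ 2 / lam * (lam / γ) = γ := by field_simp
  have e2 : γ * (γ / lam) = r := by rw [hr]; ring
  rw [e1] at h4'
  rw [← hr] at h5 ⊢
  have e3 : γ * γ⁻¹ = 1 := by field_simp
  rw [mul_zero, mul_add, mul_add] at h3'
  rw [inner_smul_left, inner_smul_left, ← mul_assoc, ← mul_assoc] at h3'
  simp only [conj_trivial, e3, one_mul] at h3'
  have e4 : inner ℝ (y' - ys) (A v + (γ / lam) • (y - y') - A xs) =
      inner ℝ (adjoint A y' - adjoint A ys) (v - xs) + γ / lam * inner ℝ (y' - ys) (y - y') := by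
    rw [← map_sub, adjoint_inner_left, map_sub, ← inner_smul_right, ← inner_add_right]
    congr 1; abel
  have e5 : 2 * inner ℝ (y' - ys) (y - y') = ‖y - ys‖ ^ 2 - ‖y' - ys‖ ^ 2 - ‖y' - y‖ ^ 2 := by
    rw [show y - ys = (y' - ys) + (y - y') by abel, norm_add_sq_real, norm_sub_rev y' y]; ring
  rw [e4, mul_add, ← mul_assoc, e2] at h4'
  have h7 : 2 * (r * inner ℝ (y' - ys) (y - y')) =
      r * (‖y - ys‖ ^ 2 - ‖y' - ys‖ ^ 2 - ‖y' - y‖ ^ 2) := by rw [← e5]; ring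
  rw [norm_sub_sq_real, norm_smul, mul_pow, Real.norm_of_nonneg hγ.le] at h6
  rw [map_sub] at h5 h6
  generalize adjoint A y' = b' at *
  generalize adjoint A y = b at *
  generalize adjoint A ys = bs at *
  have h8 : 2 * inner ℝ (γ • (b' - b)) (v - x') ≤
      r * θ * ‖y' - y‖ ^ 2 + ‖v - x'‖ ^ 2 := by linarith
  -- A polarization identity grouping the three-cyclic sum, the dual coupling, the cross term of
  -- `h8` and the `a` term.
  have h9 : ‖x' - xs‖ ^ 2 + ‖x - v‖ ^ 2 + ‖v - x'‖ ^ 2 - ‖x - xs‖ ^ 2 =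
      2 * (inner ℝ (x - γ • a - γ • b - v) (x' - v) +
        inner ℝ (x - γ • a - γ • b' - x') (xs - x') + γ * inner ℝ (-as - bs) (v - xs))
      - 2 * (γ * inner ℝ (b' - bs) (v - xs)) + 2 * inner ℝ (γ • (b' - b)) (v - x')
      + 2 * γ * inner ℝ (a - as) (xs - v) := by
    simp only [← real_inner_self_eq_norm_sq, inner_sub_left, inner_sub_right, inner_smul_left,
      inner_neg_left, conj_trivial]
    linarith [real_inner_comm x x', real_inner_comm x xs, real_inner_comm x v,
      real_inner_comm x' xs, real_inner_comm x' v, real_inner_comm xs v]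
  linarith

end Abstract
-- Weak limits and a descent lemma for real sequences
section WeakLimits

variable {H : Type*} [NormedAddCommGroup H] [InnerProductSpace ℝ H] {ι : Type*}

/-- Weak convergence in a Hilbert space, tested against vectors. -/
def WeakTendsto (x : ι → H) (l : Filter ι) (a : H) : Prop :=
  ∀ z : H, Tendsto (fun k => inner ℝ (x k) z) l (𝓝 (inner ℝ a z))

lemma WeakTendsto.of_sub_tendsto_zero {x v : ι → H} {l : Filter ι} {a : H}
    (hx : WeakTendsto x l a) (h : Tendsto (fun k => x k - v k) l (𝓝 0)) :
    WeakTendsto v l a := by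
  intro z
  have h1 : Tendsto (fun k => inner ℝ (x k - v k) z) l (𝓝 (inner ℝ 0 z)) :=
    h.inner tendsto_const_nhds
  simpa [inner_sub_left] using (hx z).sub h1

lemma tendsto_inner_zero_of_bounded {a b : ι → H} {l : Filter ι} {C : ℝ}
    (ha : Tendsto a l (𝓝 0)) (hb : ∀ k, ‖b k‖ ≤ C) :
    Tendsto (fun k => inner ℝ (a k) (b k)) l (𝓝 0) := by
  refine squeeze_zero_norm (a := fun k => ‖a k‖ * C) (fun k => ?_) ?_
  · exact (norm_inner_le_norm _ _).trans (mul_le_mul_of_nonneg_left (hb k) (norm_nonneg _))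
  · simpa using ha.norm.mul_const C

lemma WeakTendsto.inner_of_tendsto {x a : ι → H} {l : Filter ι} {x₀ a₀ : H} {C : ℝ}
    (hx : WeakTendsto x l x₀) (hC : ∀ k, ‖x k‖ ≤ C) (ha : Tendsto a l (𝓝 a₀)) :
    Tendsto (fun k => inner ℝ (a k) (x k)) l (𝓝 (inner ℝ a₀ x₀)) := by
  have h1 := tendsto_inner_zero_of_bounded (a := fun k => a k - a₀)
    (by simpa using ha.sub_const a₀) hC
  have h2 := h1.add (hx a₀)
  rw [zero_add, real_inner_comm] at h2
  refine h2.congr fun k => ?_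
  rw [inner_sub_left, real_inner_comm a₀ (x k)]; ring

/-- The terms `‖x k‖²` cancel, so the difference is affine in `x k` and hence weakly continuous.
Opial's argument rests on this. -/
lemma WeakTendsto.norm_sub_sq_sub {x : ι → H} {l : Filter ι} {a : H} (hx : WeakTendsto x l a)
    (s t : H) : Tendsto (fun k => ‖x k - s‖ ^ 2 - ‖x k - t‖ ^ 2) l
      (𝓝 (‖a - s‖ ^ 2 - ‖a - t‖ ^ 2)) := by
  have key : ∀ b : H, ‖b - s‖ ^ 2 - ‖b - t‖ ^ 2 =
      -2 * inner ℝ b (s - t) + (‖s‖ ^ 2 - ‖t‖ ^ 2) := fun b => by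
    rw [norm_sub_sq_real, norm_sub_sq_real, inner_sub_right]; ring
  simp only [key]
  exact ((hx _).const_mul _).add_const _

end WeakLimits

lemma exists_tendsto_of_add_le {V W : ℕ → ℝ} (hV : ∀ k, 0 ≤ V k) (hW : ∀ k, 0 ≤ W k)
    (h : ∀ k, V (k + 1) + W k ≤ V k) :
    (∃ l, Tendsto V atTop (𝓝 l)) ∧ (∀ k, V k ≤ V 0) ∧ Tendsto W atTop (𝓝 0) := by
  have hanti : Antitone V := antitone_nat_of_succ_le fun k => by linarith [h k, hW k]
  have hl := tendsto_atTop_ciInf hanti ⟨0, by rintro _ ⟨k, rfl⟩; exact hV k⟩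
  refine ⟨⟨_, hl⟩, fun k => hanti (Nat.zero_le k), ?_⟩
  have h1 : Tendsto (fun k => V k - V (k + 1)) atTop (𝓝 0) := by
    simpa using hl.sub (hl.comp (tendsto_add_atTop_nat 1))
  exact squeeze_zero hW (fun k => by linarith [h k]) h1

/-! ### Weak convergence of the abstract primal-dual scheme -/

section Convergence

variable {H K : Type*} [NormedAddCommGroup H] [InnerProductSpace ℝ H] [CompleteSpace H]
  [NormedAddCommGroup K] [InnerProductSpace ℝ K] [CompleteSpace K]

open ContinuousLinearMap

/-- The primal-dual inclusions `-F x - A* y ∈ M x`, `A x ∈ N y`. -/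
def IsPrimalDualZero (M : H → H → Prop) (N : K → K → Prop) (F : H → H) (A : H →L[ℝ] K)
    (xs : H) (ys : K) : Prop :=
  M xs (-F xs - adjoint A ys) ∧ N ys (A xs)

/-- A sequence of the primal-dual fixed point scheme, written in terms of the operators
`M = ∂g` and `N = ∂h*`. -/
structure IsPDFPOrbit (M : H → H → Prop) (N : K → K → Prop) (F : H → H) (A : H →L[ℝ] K)
    (γ lam : ℝ) (x v : ℕ → H) (y : ℕ → K) : Prop where
  aux : ∀ k, M (v k) (γ⁻¹ • (x k - γ • F (x k) - γ • adjoint A (y k) - v k))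
  dual : ∀ k, N (y (k + 1)) (A (v k) + (γ / lam) • (y k - y (k + 1)))
  primal : ∀ k, M (x (k + 1)) (γ⁻¹ • (x k - γ • F (x k) - γ • adjoint A (y (k + 1)) - x (k + 1)))

variable {M : H → H → Prop} {N : K → K → Prop} {F : H → H} {A : H →L[ℝ] K}
  {γ lam θ β : ℝ} {x v : ℕ → H} {y : ℕ → K}

lemma IsPDFPOrbit.asymptotics (hS : IsPDFPOrbit M N F A γ lam x v y)
    (hM : IsThreeCyclic M) (hN : IsMonotoneRel N)
    (hF : ∀ p q, β * ‖F p - F q‖ ^ 2 ≤ inner ℝ (F p - F q) (p - q))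
    (hγ : 0 < γ) (hγβ : γ < 2 * β) (hlam : 0 < lam) (hθ : θ < 1)
    (hA : ∀ y, lam * ‖adjoint A y‖ ^ 2 ≤ θ * ‖y‖ ^ 2) {xs : H} {ys : K}
    (hs : IsPrimalDualZero M N F A xs ys) :
    (∃ l, Tendsto (fun k => ‖x k - xs‖ ^ 2 + γ ^ 2 / lam * ‖y k - ys‖ ^ 2) atTop (𝓝 l)) ∧
    (∃ C, ∀ k, ‖x k‖ ≤ C ∧ ‖y k‖ ≤ C) ∧
    Tendsto (fun k => x k - v k) atTop (𝓝 0) ∧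
    Tendsto (fun k => y (k + 1) - y k) atTop (𝓝 0) ∧
    Tendsto (fun k => F (x k)) atTop (𝓝 (F xs)) := by
  have hβ : 0 < β := by linarith
  have hr : 0 < γ ^ 2 / lam := by positivity
  -- `s` is the Young parameter splitting `2γ⟨F x - F xs, x - v⟩`. Keeping part of `‖x - v‖²` needs
  -- `s < 1`, and keeping part of the cocoercivity gain needs `s > γ / (2β)`. The midpoint of that
  -- interval serves.
  obtain ⟨s, hs0, hs1, hs2⟩ : ∃ s, 0 < s ∧ s < 1 ∧ 0 < 2 * γ * β - γ ^ 2 / s := by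
    have ht : γ / (2 * β) < 1 := (div_lt_one (by linarith)).2 hγβ
    have ht0 : 0 < γ / (2 * β) := by positivity
    refine ⟨(1 + γ / (2 * β)) / 2, by linarith, by linarith, ?_⟩
    rw [sub_pos, div_lt_iff₀ (by linarith)]
    have : 2 * γ * β * ((1 + γ / (2 * β)) / 2) = γ * β + γ ^ 2 / 2 := by field_simp
    rw [this]; nlinarith
  have hstep : ∀ k, (‖x (k + 1) - xs‖ ^ 2 + γ ^ 2 / lam * ‖y (k + 1) - ys‖ ^ 2) +
      ((1 - s) * ‖x k - v k‖ ^ 2 + γ ^ 2 / lam * (1 - θ) * ‖y (k + 1) - y k‖ ^ 2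
        + (2 * γ * β - γ ^ 2 / s) * ‖F (x k) - F xs‖ ^ 2) ≤
      ‖x k - xs‖ ^ 2 + γ ^ 2 / lam * ‖y k - ys‖ ^ 2 := by
    intro k
    have h1 := pdfp_step hM hN A hγ hlam hA (hS.aux k) (hS.primal k) (hS.dual k) hs.1 hs.2
    have h2 : inner ℝ (F (x k) - F xs) (xs - v k) =
        inner ℝ (F (x k) - F xs) (x k - v k) - inner ℝ (F (x k) - F xs) (x k - xs) := by
      rw [← inner_sub_right]; congr 1; abel
    have h3 := mul_le_mul_of_nonneg_left (hF (x k) xs) (by linarith : 0 ≤ 2 * γ)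
    have h4 : 2 * γ * inner ℝ (F (x k) - F xs) (x k - v k) ≤
        s * ‖x k - v k‖ ^ 2 + γ ^ 2 / s * ‖F (x k) - F xs‖ ^ 2 := by
      have h5 := mul_le_mul_of_nonneg_left
        (real_inner_le_norm (F (x k) - F xs) (x k - v k)) (by linarith : 0 ≤ 2 * γ)
      have h6 : s * ‖x k - v k‖ ^ 2 + γ ^ 2 / s * ‖F (x k) - F xs‖ ^ 2 -
          2 * γ * (‖F (x k) - F xs‖ * ‖x k - v k‖) =
          (s * ‖x k - v k‖ - γ * ‖F (x k) - F xs‖) ^ 2 / s := by field_simp; ring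
      have h7 : 0 ≤ (s * ‖x k - v k‖ - γ * ‖F (x k) - F xs‖) ^ 2 / s := by positivity
      linarith
    rw [h2] at h1
    linarith
  have c1 : 0 < 1 - s := by linarith
  have c2 : 0 < γ ^ 2 / lam * (1 - θ) := mul_pos hr (by linarith)
  obtain ⟨hl, hb, hW⟩ := exists_tendsto_of_add_le
    (V := fun k => ‖x k - xs‖ ^ 2 + γ ^ 2 / lam * ‖y k - ys‖ ^ 2)
    (W := fun k => (1 - s) * ‖x k - v k‖ ^ 2
      + γ ^ 2 / lam * (1 - θ) * ‖y (k + 1) - y k‖ ^ 2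
      + (2 * γ * β - γ ^ 2 / s) * ‖F (x k) - F xs‖ ^ 2)
    (fun k => by positivity) (fun k => by positivity) hstep
  have aux : ∀ (a : ℕ → ℝ) (c : ℝ), 0 < c → (∀ k, 0 ≤ a k) →
      (∀ k, c * a k ^ 2 ≤ (1 - s) * ‖x k - v k‖ ^ 2
        + γ ^ 2 / lam * (1 - θ) * ‖y (k + 1) - y k‖ ^ 2
        + (2 * γ * β - γ ^ 2 / s) * ‖F (x k) - F xs‖ ^ 2) → Tendsto a atTop (𝓝 0) := by
    intro a c hc ha0 ha
    have h1 : Tendsto (fun k => c * a k ^ 2) atTop (𝓝 0) :=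
      squeeze_zero (fun k => by positivity) ha hW
    have h2 : Tendsto (fun k => a k ^ 2) atTop (𝓝 0) := by
      have := h1.const_mul c⁻¹
      simpa [← mul_assoc, inv_mul_cancel₀ hc.ne'] using this
    have h3 := h2.sqrt
    simpa only [Real.sqrt_sq (ha0 _), Real.sqrt_zero] using h3
  refine ⟨hl, ?_, ?_, ?_, ?_⟩
  · set V0 := ‖x 0 - xs‖ ^ 2 + γ ^ 2 / lam * ‖y 0 - ys‖ ^ 2 with hV0
    refine ⟨max (√V0 + ‖xs‖) (√(V0 / (γ ^ 2 / lam)) + ‖ys‖), fun k => ⟨?_, ?_⟩⟩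
    · refine le_trans ?_ (le_max_left _ _)
      have : ‖x k - xs‖ ≤ √V0 := Real.le_sqrt_of_sq_le (by
        have := hb k
        have h2 : 0 ≤ γ ^ 2 / lam * ‖y k - ys‖ ^ 2 := by positivity
        linarith)
      linarith [norm_le_norm_sub_add (x k) xs]
    · refine le_trans ?_ (le_max_right _ _)
      have : ‖y k - ys‖ ≤ √(V0 / (γ ^ 2 / lam)) := Real.le_sqrt_of_sq_le (by
        rw [le_div_iff₀ hr]
        have := hb k
        have h2 : 0 ≤ ‖x k - xs‖ ^ 2 := by positivity
        linarith)
      linarith [norm_le_norm_sub_add (y k) ys]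
  · refine tendsto_zero_iff_norm_tendsto_zero.2 (aux _ (1 - s) c1
        (fun _ => norm_nonneg _) fun k => ?_)
    have : 0 ≤ γ ^ 2 / lam * (1 - θ) * ‖y (k + 1) - y k‖ ^ 2
        + (2 * γ * β - γ ^ 2 / s) * ‖F (x k) - F xs‖ ^ 2 := by positivity
    linarith
  · refine tendsto_zero_iff_norm_tendsto_zero.2 (aux _ (γ ^ 2 / lam * (1 - θ)) c2
        (fun _ => norm_nonneg _) fun k => ?_)
    have : 0 ≤ (1 - s) * ‖x k - v k‖ ^ 2
        + (2 * γ * β - γ ^ 2 / s) * ‖F (x k) - F xs‖ ^ 2 := by positivity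
    linarith
  · have : Tendsto (fun k => F (x k) - F xs) atTop (𝓝 0) := by
      refine tendsto_zero_iff_norm_tendsto_zero.2 (aux _ (2 * γ * β - γ ^ 2 / s) hs2
        (fun _ => norm_nonneg _) fun k => ?_)
      have : 0 ≤ (1 - s) * ‖x k - v k‖ ^ 2
        + γ ^ 2 / lam * (1 - θ) * ‖y (k + 1) - y k‖ ^ 2 := by positivity
      linarith
    simpa using this.add_const (F xs)

/-- Minty's trick: the orbit inclusions are tested against resolvent points built from the weak
limit. The coupling terms `⟨A* y_k, v_k⟩` and `⟨y_{k+1}, A v_k⟩`, products of weakly convergent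
sequences, cancel up to a strongly vanishing factor. -/
lemma IsPDFPOrbit.isPrimalDualZero_of_weakTendsto (hS : IsPDFPOrbit M N F A γ lam x v y)
    (hM : IsMonotoneRel M) (hN : IsMonotoneRel N) (hMr : HasResolvent M) (hNr : HasResolvent N)
    (hF : ∀ p q, β * ‖F p - F q‖ ^ 2 ≤ inner ℝ (F p - F q) (p - q)) (hβ : 0 < β)
    (hγ : 0 < γ) {C : ℝ} (hC : ∀ k, ‖x k‖ ≤ C ∧ ‖y k‖ ≤ C) {l : Filter ℕ} [l.NeBot]
    (hxv : Tendsto (fun k => x k - v k) l (𝓝 0))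
    (hyy : Tendsto (fun k => y (k + 1) - y k) l (𝓝 0)) {a : H}
    (hFx : Tendsto (fun k => F (x k)) l (𝓝 a)) {x₀ : H} {y₀ : K}
    (hx : WeakTendsto x l x₀) (hy : WeakTendsto y l y₀) :
    IsPrimalDualZero M N F A x₀ y₀ := by
  -- Cocoercivity bounds `β‖F (x k) - F x₀‖²` by the pairing of a strongly convergent sequence with
  -- `x k - x₀ ⇀ 0`.
  have hFx₀ : F x₀ = a := by
    have h1 : Tendsto (fun k => inner ℝ (F (x k) - F x₀) (x k - x₀)) l (𝓝 0) := by
      have h2 := hx.inner_of_tendsto (fun k => (hC k).1) (hFx.sub_const (F x₀))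
      have h3 : Tendsto (fun k => inner ℝ (F (x k) - F x₀) x₀) l (𝓝 (inner ℝ (a - F x₀) x₀)) :=
        (hFx.sub_const (F x₀)).inner tendsto_const_nhds
      simpa [inner_sub_right] using h2.sub h3
    have h4 : Tendsto (fun k => β * ‖F (x k) - F x₀‖ ^ 2) l (𝓝 (β * ‖a - F x₀‖ ^ 2)) :=
      ((hFx.sub_const (F x₀)).norm.pow 2).const_mul β
    have h5 := le_of_tendsto_of_tendsto' h4 h1 fun k => hF (x k) x₀
    have h6 : ‖a - F x₀‖ ^ 2 ≤ 0 := by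
      by_contra h; push Not at h; nlinarith
    have h7 : ‖a - F x₀‖ = 0 := by nlinarith [norm_nonneg (a - F x₀)]
    exact (sub_eq_zero.1 (norm_eq_zero.1 h7)).symm
  subst hFx₀
  have hv := hx.of_sub_tendsto_zero hxv
  have hy' : WeakTendsto (fun k => y (k + 1)) l y₀ :=
    hy.of_sub_tendsto_zero (by simpa using hyy.neg)
  have hv_inner : ∀ {a : ℕ → H} {a₀ : H}, Tendsto a l (𝓝 a₀) →
      Tendsto (fun k => inner ℝ (a k) (v k)) l (𝓝 (inner ℝ a₀ x₀)) := by
    intro a a₀ ha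
    have h1 := (hx.inner_of_tendsto (fun k => (hC k).1) ha).sub (ha.inner hxv)
    rw [inner_zero_right, sub_zero] at h1
    exact h1.congr fun k => by rw [← inner_sub_right, sub_sub_cancel]
  -- The arguments are chosen so that `-F x₀ - A* y₀ - p' = -(x₀ - p)` and `A x₀ - q' = -(y₀ - q)`.
  -- The limiting inequality then reads `0 ≤ -‖x₀ - p‖² - ‖y₀ - q‖²`.
  obtain ⟨p, hp⟩ := hMr (x₀ - F x₀ - adjoint A y₀)
  obtain ⟨q, hq⟩ := hNr (y₀ + A x₀)
  set p' := x₀ - F x₀ - adjoint A y₀ - p with hp'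
  set q' := y₀ + A x₀ - q with hq'
  have hyy0 : Tendsto (fun k => y k - y (k + 1)) l (𝓝 0) := by simpa using hyy.neg
  have ha : Tendsto (fun k => γ⁻¹ • (x k - v k) - F (x k) - p') l (𝓝 (-F x₀ - p')) := by
    simpa using ((hxv.const_smul γ⁻¹).sub hFx).sub_const p'
  have ha' : Tendsto (fun k => γ⁻¹ • (x k - v k) - F (x k) - p' - adjoint A (y k - y (k + 1))
      - adjoint A q) l (𝓝 (-F x₀ - p' - adjoint A q)) := by
    have := ((adjoint A).continuous.tendsto 0).comp hyy0
    simpa using (ha.sub this).sub_const (adjoint A q)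
  have hb : Tendsto (fun k => (γ / lam) • (y k - y (k + 1)) - q') l (𝓝 (-q')) := by
    simpa using (hyy0.const_smul (γ / lam)).sub_const q'
  -- This is the sum of the two monotonicity pairings after the cancellation. Each remaining product
  -- has a strongly convergent or constant factor.
  have hlim := ((((hv_inner ha').sub (ha.inner (tendsto_const_nhds (x := p)))).add
    (hy (A p))).add (hy'.inner_of_tendsto (fun k => (hC (k + 1)).2) hb)).sub
    (hb.inner (tendsto_const_nhds (x := q)))
  have hγγ : γ⁻¹ * γ = 1 := inv_mul_cancel₀ hγ.ne'
  have hnonneg := ge_of_tendsto' (b := 0) hlim fun k => by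
    have h1 := hM (hS.aux k) hp
    have h2 := hN (hS.dual k) hq
    have h3 : γ⁻¹ • (x k - γ • F (x k) - γ • adjoint A (y k) - v k) - p' =
        (γ⁻¹ • (x k - v k) - F (x k) - p') - adjoint A (y k) := by
      have : x k - γ • F (x k) - γ • adjoint A (y k) - v k =
        (x k - v k) - γ • F (x k) - γ • adjoint A (y k) := by abel
      rw [this, smul_sub, smul_sub, smul_smul, smul_smul, hγγ, one_smul, one_smul]; abel
    have h4 : A (v k) + (γ / lam) • (y k - y (k + 1)) - q' =
        ((γ / lam) • (y k - y (k + 1)) - q') + A (v k) := by abel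
    rw [h3] at h1
    rw [h4] at h2
    generalize γ⁻¹ • (x k - v k) - F (x k) - p' = e at *
    generalize (γ / lam) • (y k - y (k + 1)) - q' = e' at *
    simp only [inner_sub_left, inner_sub_right, inner_add_right, map_sub,
      adjoint_inner_left, adjoint_inner_right] at h1 h2 ⊢
    linarith [real_inner_comm (v k) e, real_inner_comm p e, real_inner_comm (y (k + 1)) e',
      real_inner_comm q e', real_inner_comm (y k) (A (v k)), real_inner_comm (y k) (A p),
      real_inner_comm (y (k + 1)) (A (v k)), real_inner_comm (y (k + 1)) (A p)]
  have hsum : ‖x₀ - p‖ ^ 2 + ‖y₀ - q‖ ^ 2 ≤ 0 := by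
    have h1 : inner ℝ (x₀ - p) (-F x₀ - adjoint A y₀ - p') = -‖x₀ - p‖ ^ 2 := by
      rw [← real_inner_self_eq_norm_sq, ← inner_neg_right, hp']; congr 1; abel
    have h2 : inner ℝ (y₀ - q) (A x₀ - q') = -‖y₀ - q‖ ^ 2 := by
      rw [← real_inner_self_eq_norm_sq, ← inner_neg_right, hq']; congr 1; abel
    have h3 : -F x₀ - adjoint A y₀ - p' = (-F x₀ - p') - adjoint A y₀ := by abel
    rw [h3] at h1
    generalize -F x₀ - p' = e at *
    simp only [inner_sub_left, inner_sub_right, inner_neg_left, map_sub,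
      adjoint_inner_left, adjoint_inner_right] at h1 h2 hnonneg
    linarith [real_inner_comm x₀ e, real_inner_comm p e, real_inner_comm y₀ q',
      real_inner_comm q q', real_inner_comm y₀ (A x₀), real_inner_comm y₀ (A p),
      real_inner_comm q (A x₀)]
  have hxp : x₀ - p = 0 := norm_eq_zero.1 (by nlinarith [norm_nonneg (x₀ - p), sq_nonneg ‖y₀ - q‖])
  have hyq : y₀ - q = 0 := norm_eq_zero.1 (by nlinarith [norm_nonneg (y₀ - q), sq_nonneg ‖x₀ - p‖])
  obtain rfl := sub_eq_zero.1 hxp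
  obtain rfl := sub_eq_zero.1 hyq
  refine ⟨?_, ?_⟩
  · convert hp using 1; rw [hp']; abel
  · convert hq using 1; rw [hq']; abel

/-- Opial's argument: the weighted squared distances to two cluster points both converge, and their
difference is weakly continuous. Its values at the two cluster points are therefore equal, yet
opposite in sign, so both vanish. -/
theorem IsPDFPOrbit.exists_weak_limit (hS : IsPDFPOrbit M N F A γ lam x v y)
    (hM : IsThreeCyclic M) (hN : IsMonotoneRel N) (hMr : HasResolvent M) (hNr : HasResolvent N)
    (hF : ∀ p q, β * ‖F p - F q‖ ^ 2 ≤ inner ℝ (F p - F q) (p - q))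
    (hγ : 0 < γ) (hγβ : γ < 2 * β) (hlam : 0 < lam) (hθ : θ < 1)
    (hA : ∀ y, lam * ‖adjoint A y‖ ^ 2 ≤ θ * ‖y‖ ^ 2)
    (hsol : ∃ xs ys, IsPrimalDualZero M N F A xs ys) :
    ∃ xs ys, IsPrimalDualZero M N F A xs ys ∧ WeakTendsto x atTop xs := by
  obtain ⟨xs, ys, hs⟩ := hsol
  obtain ⟨-, ⟨C, hC⟩, hxv, hyy, hFx⟩ := hS.asymptotics hM hN hF hγ hγβ hlam hθ hA hs
  have cluster : ∀ U : Ultrafilter ℕ, (U : Filter ℕ) ≤ atTop → ∃ x₀ y₀,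
      WeakTendsto x U x₀ ∧ WeakTendsto y U y₀ ∧ IsPrimalDualZero M N F A x₀ y₀ := by
    intro U hU
    obtain ⟨x₀, hx₀⟩ := CompositeSplitting.exists_weak_limit U fun k => (hC k).1
    obtain ⟨y₀, hy₀⟩ := CompositeSplitting.exists_weak_limit U fun k => (hC k).2
    exact ⟨x₀, y₀, hx₀, hy₀, hS.isPrimalDualZero_of_weakTendsto hM.isMonotoneRel hN hMr hNr hF
      (by linarith) hγ hC (hxv.mono_left hU) (hyy.mono_left hU) (hFx.mono_left hU) hx₀ hy₀⟩
  obtain ⟨x₀, y₀, hx₀, hy₀, hs₀⟩ := cluster (Ultrafilter.of atTop) (Ultrafilter.of_le _)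
  refine ⟨x₀, y₀, hs₀, fun z => ?_⟩
  rw [tendsto_iff_ultrafilter]
  intro U hU
  obtain ⟨x₁, y₁, hx₁, hy₁, hs₁⟩ := cluster U hU
  obtain ⟨⟨l₀, hl₀⟩, -⟩ := hS.asymptotics hM hN hF hγ hγβ hlam hθ hA hs₀
  obtain ⟨⟨l₁, hl₁⟩, -⟩ := hS.asymptotics hM hN hF hγ hγβ hlam hθ hA hs₁
  have key : ∀ (U : Ultrafilter ℕ) (p : H) (q : K), (U : Filter ℕ) ≤ atTop →
      WeakTendsto x U p → WeakTendsto y U q →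
      (‖p - x₀‖ ^ 2 - ‖p - x₁‖ ^ 2) + γ ^ 2 / lam * (‖q - y₀‖ ^ 2 - ‖q - y₁‖ ^ 2) = l₀ - l₁ := by
    intro U p q hU hp hq
    refine tendsto_nhds_unique ((hp.norm_sub_sq_sub x₀ x₁).add
      ((hq.norm_sub_sq_sub y₀ y₁).const_mul _)) (((hl₀.sub hl₁).mono_left hU).congr fun k => ?_)
    ring
  have k0 := key _ _ _ (Ultrafilter.of_le _) hx₀ hy₀
  have k1 := key _ _ _ hU hx₁ hy₁
  have hr : 0 < γ ^ 2 / lam := by positivity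
  rw [← k0] at k1
  simp only [sub_self, norm_zero] at k1
  rw [norm_sub_rev x₀ x₁, norm_sub_rev y₀ y₁] at k1
  have h1 : 0 ≤ γ ^ 2 / lam * ‖y₁ - y₀‖ ^ 2 := by positivity
  have h2 : ‖x₁ - x₀‖ = 0 := by nlinarith [norm_nonneg (x₁ - x₀)]
  rw [← sub_eq_zero.1 (norm_eq_zero.1 h2)]
  exact hx₁ z

end Convergence
-- Smooth convex functions: descent lemma and cocoercivity
section Smooth

variable {H : Type*} [NormedAddCommGroup H] [InnerProductSpace ℝ H] [CompleteSpace H] {f : H → ℝ}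

lemma hasDerivAt_comp_add_smul (hf : Differentiable ℝ f) (x d : H) (t : ℝ) :
    HasDerivAt (fun s : ℝ => f (x + s • d)) (inner ℝ (gradient f (x + t • d)) d) t := by
  have h1 : HasDerivAt (fun s : ℝ => x + s • d) d t := by
    simpa using ((hasDerivAt_id t).smul_const d).const_add x
  have h2 := (hf (x + t • d)).hasFDerivAt.comp_hasDerivAt t h1
  rwa [inner_gradient_left]

lemma add_inner_gradient_le_of_convexOn (hc : ConvexOn ℝ Set.univ f) (hf : Differentiable ℝ f)
    (x z : H) : f x + inner ℝ (gradient f x) (z - x) ≤ f z := by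
  have h1 : ConvexOn ℝ Set.univ (fun s : ℝ => f (x + s • (z - x))) := by
    have := hc.comp_affineMap (AffineMap.lineMap x z)
    simpa [Function.comp_def, AffineMap.lineMap_apply, add_comm] using this
  have h2 := hasDerivAt_comp_add_smul hf x (z - x) 0
  have h3 := h1.le_slope_of_hasDerivAt (Set.mem_univ 0) (Set.mem_univ 1) one_pos h2
  simp [slope_def_field, -inner_gradient_left] at h3
  linarith

lemma le_add_inner_gradient_add_sq (hf : Differentiable ℝ f) {L : ℝ≥0}
    (hL : LipschitzWith L (gradient f)) (x d : H) :
    f (x + d) ≤ f x + inner ℝ (gradient f x) d + L / 2 * ‖d‖ ^ 2 := by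
  have hder : ∀ t : ℝ, HasDerivAt
      (fun s : ℝ => f (x + s • d) - s * inner ℝ (gradient f x) d - s ^ 2 * (L / 2 * ‖d‖ ^ 2))
      (inner ℝ (gradient f (x + t • d)) d - inner ℝ (gradient f x) d - t * (L * ‖d‖ ^ 2)) t := by
    intro t
    have h1 := ((hasDerivAt_comp_add_smul hf x d t).sub
      ((hasDerivAt_id t).mul_const (inner ℝ (gradient f x) d))).sub
      ((hasDerivAt_pow 2 t).mul_const (L / 2 * ‖d‖ ^ 2))
    refine h1.congr_deriv ?_
    simp; ring
  have hanti := antitoneOn_of_deriv_nonpos (convex_Icc (0 : ℝ) 1)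
    (fun t _ => (hder t).continuousAt.continuousWithinAt)
    (fun t _ => (hder t).differentiableAt.differentiableWithinAt) (fun t ht => by
      rw [interior_Icc] at ht
      rw [(hder t).deriv, ← inner_sub_left]
      have h1 := real_inner_le_norm (gradient f (x + t • d) - gradient f x) d
      have h2 : ‖gradient f (x + t • d) - gradient f x‖ ≤ L * (t * ‖d‖) := by
        have := hL.norm_sub_le (x + t • d) x
        rwa [add_sub_cancel_left, norm_smul, Real.norm_of_nonneg ht.1.le] at this
      have h3 := mul_le_mul_of_nonneg_right h2 (norm_nonneg d)
      nlinarith)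
  have h1 := hanti (by simp : (0 : ℝ) ∈ Set.Icc 0 1) (by simp : (1 : ℝ) ∈ Set.Icc 0 1) zero_le_one
  simp [-inner_gradient_left] at h1
  linarith

/-- Baillon–Haddad: the gradient of a convex function with `L`-Lipschitz gradient is
`1 / L`-cocoercive. -/
lemma inner_gradient_sub_ge (hc : ConvexOn ℝ Set.univ f) (hf : Differentiable ℝ f) {L : ℝ≥0}
    (hL0 : 0 < L) (hL : LipschitzWith L (gradient f)) (p q : H) :
    1 / (L : ℝ) * ‖gradient f p - gradient f q‖ ^ 2 ≤
      inner ℝ (gradient f p - gradient f q) (p - q) := by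
  have hL' : (0 : ℝ) < L := hL0
  -- The gradient step `p - (1/L)(∇f p - ∇f q)` is bounded above by the descent lemma at `p` and
  -- below by the tangent at `q`. Adding the version with `p` and `q` swapped gives cocoercivity.
  have key : ∀ p q : H, f q + inner ℝ (gradient f q) (p - q)
      + 1 / (2 * L) * ‖gradient f p - gradient f q‖ ^ 2 ≤ f p := by
    intro p q
    have h1 := le_add_inner_gradient_add_sq hf hL p
      (-((1 / (L : ℝ)) • (gradient f p - gradient f q)))
    have h2 := add_inner_gradient_le_of_convexOn hc hf q
      (p + -((1 / (L : ℝ)) • (gradient f p - gradient f q)))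
    have h3 : p + -((1 / (L : ℝ)) • (gradient f p - gradient f q)) - q =
      (p - q) + -((1 / (L : ℝ)) • (gradient f p - gradient f q)) := by abel
    have h4 := real_inner_self_eq_norm_sq (gradient f p - gradient f q)
    rw [inner_sub_left] at h4
    rw [h3, inner_add_right] at h2
    rw [norm_neg, norm_smul, mul_pow, Real.norm_of_nonneg (by positivity)] at h1
    rw [inner_neg_right, inner_smul_right] at h1 h2
    have h5 : (L : ℝ) / 2 * ((1 / L) ^ 2 * ‖gradient f p - gradient f q‖ ^ 2) =
      1 / (2 * L) * ‖gradient f p - gradient f q‖ ^ 2 := by field_simp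
    have h6 : 2 * (1 / (2 * L) * ‖gradient f p - gradient f q‖ ^ 2) =
      1 / (L : ℝ) * ‖gradient f p - gradient f q‖ ^ 2 := by field_simp
    rw [h5] at h1
    nth_rewrite 2 [← h4] at h6
    rw [mul_sub] at h6
    linarith
  have h1 := key p q
  have h2 := key q p
  rw [norm_sub_rev, ← neg_sub p q, inner_neg_right] at h2
  rw [inner_sub_left]
  have : 1 / (L : ℝ) * ‖gradient f p - gradient f q‖ ^ 2 =
      2 * (1 / (2 * L) * ‖gradient f p - gradient f q‖ ^ 2) := by field_simp
  linarith

end Smooth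

/-! ### Subdifferentials and existence of proximal points -/

section Subdifferential

variable {E : Type*} [NormedAddCommGroup E] [InnerProductSpace ℝ E] {φ : E → EReal}

lemma Gamma0.exists_coe_of_mem_subdiff (hφ : Gamma0 φ) {x q : E} (hq : q ∈ subdiff φ x) :
    ∃ a : ℝ, φ x = a ∧ ∀ z, ((a + inner ℝ q (z - x) : ℝ) : EReal) ≤ φ z := by
  have htop : φ x ≠ ⊤ := by
    intro h
    obtain ⟨z, hz⟩ := hφ.exists_ne_top
    have := hq z
    rw [h, EReal.top_add_coe, top_le_iff] at this
    exact hz this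
  obtain ⟨a, ha⟩ : ∃ a : ℝ, φ x = a := ⟨_, (EReal.coe_toReal htop (hφ.ne_bot x)).symm⟩
  refine ⟨a, ha, fun z => ?_⟩
  have := hq z
  rwa [ha, ← EReal.coe_add] at this

lemma Gamma0.isThreeCyclic (hφ : Gamma0 φ) : IsThreeCyclic fun p q => q ∈ subdiff φ p := by
  intro p₁ q₁ p₂ q₂ p₃ q₃ h₁ h₂ h₃
  obtain ⟨a₁, e₁, i₁⟩ := hφ.exists_coe_of_mem_subdiff h₁
  obtain ⟨a₂, e₂, i₂⟩ := hφ.exists_coe_of_mem_subdiff h₂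
  obtain ⟨a₃, e₃, i₃⟩ := hφ.exists_coe_of_mem_subdiff h₃
  have j₁ := i₁ p₂
  have j₂ := i₂ p₃
  have j₃ := i₃ p₁
  rw [e₂, EReal.coe_le_coe_iff] at j₁
  rw [e₃, EReal.coe_le_coe_iff] at j₂
  rw [e₁, EReal.coe_le_coe_iff] at j₃
  linarith

/-- A point at which the prox objective has a quadratic-growth certificate is the proximal point. -/
lemma proxWith_eq {E : Type*} [AddCommGroup E] {p : E → E → ℝ} {φ : E → EReal} {c a : ℝ}
    {u x : E} (hp : ∀ d, 0 ≤ p d d) (hp0 : ∀ d, p d d = 0 → d = 0) (ha : φ x = a)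
    (h : ∀ z, ((1 / 2 * p (x - u) (x - u) + c * a + 1 / 2 * p (z - x) (z - x) : ℝ) : EReal) ≤
      ((1 / 2 * p (z - u) (z - u) : ℝ) : EReal) + (c : EReal) * φ z) :
    proxWith p φ c u = x := by
  have hx : IsProxWith p φ c u x := by
    intro z
    refine le_trans ?_ (h z)
    rw [ha]
    norm_cast
    linarith [hp (z - x)]
  have h1 : IsProxWith p φ c u (proxWith p φ c u) := Classical.epsilon_spec ⟨x, hx⟩
  have h2 := (h _).trans (h1 x)
  rw [ha] at h2
  norm_cast at h2
  exact sub_eq_zero.1 (hp0 _ (le_antisymm (by linarith) (hp _)))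

lemma Gamma0.mem_subdiff_of_isProxWith (hφ : Gamma0 φ) {c : ℝ} (hc : 0 < c) {u x : E}
    (hx : IsProxWith (fun x y : E => inner ℝ x y) φ c u x) : c⁻¹ • (u - x) ∈ subdiff φ x := by
  have hxt : φ x ≠ ⊤ := by
    intro h
    obtain ⟨z, hz⟩ := hφ.exists_ne_top
    obtain ⟨b, hb⟩ : ∃ b : ℝ, φ z = b := ⟨_, (EReal.coe_toReal hz (hφ.ne_bot z)).symm⟩
    have h1 := hx z
    rw [h, hb, EReal.coe_mul_top_of_pos hc, EReal.coe_add_top] at h1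
    exact EReal.coe_ne_top _ (top_le_iff.1 h1)
  obtain ⟨a, ha⟩ : ∃ a : ℝ, φ x = a := ⟨_, (EReal.coe_toReal hxt (hφ.ne_bot x)).symm⟩
  intro z
  by_cases hz : φ z = ⊤
  · rw [hz]; exact le_top
  obtain ⟨b, hb⟩ : ∃ b : ℝ, φ z = b := ⟨_, (EReal.coe_toReal hz (hφ.ne_bot z)).symm⟩
  -- The minimizer is compared with `(1 - t) x + t z`, and the inequality is divided by `t`. Letting
  -- `t → 0` removes the quadratic term.
  have key : ∀ t : ℝ, 0 < t → t < 1 →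
      inner ℝ (u - x) (z - x) ≤ c * (b - a) + t * (1 / 2 * ‖z - x‖ ^ 2) := by
    intro t ht0 ht1
    have h1 := hφ.convex x z (1 - t) t (by linarith) ht0 (by ring)
    rw [ha, hb] at h1
    norm_cast at h1
    have ht : φ ((1 - t) • x + t • z) ≠ ⊤ := fun h => by
      rw [h, top_le_iff] at h1; exact EReal.coe_ne_top _ h1
    obtain ⟨d, hd⟩ : ∃ d : ℝ, φ ((1 - t) • x + t • z) = d :=
      ⟨_, (EReal.coe_toReal ht (hφ.ne_bot _)).symm⟩
    have h2 := hx ((1 - t) • x + t • z)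
    rw [hd] at h1 h2
    rw [ha] at h2
    norm_cast at h1 h2
    have h3 : (1 - t) • x + t • z - u = (x - u) + t • (z - x) := by module
    simp only [h3, real_inner_self_eq_norm_sq] at h2
    rw [norm_add_sq_real,
      inner_smul_right, norm_smul, mul_pow, Real.norm_of_nonneg ht0.le] at h2
    have h4 := mul_le_mul_of_nonneg_left h1 hc.le
    have h5 : inner ℝ (u - x) (z - x) = -inner ℝ (x - u) (z - x) := by
      rw [← neg_sub x u, inner_neg_left]
    rw [h5]
    have h6 : 0 ≤ t * (inner ℝ (x - u) (z - x) + c * (b - a) + t * (1 / 2 * ‖z - x‖ ^ 2)) := by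
      nlinarith
    have h7 := nonneg_of_mul_nonneg_right h6 ht0
    linarith
  have hlim : inner ℝ (u - x) (z - x) ≤ c * (b - a) := by
    have h1 : Tendsto (fun t : ℝ => c * (b - a) + t * (1 / 2 * ‖z - x‖ ^ 2)) (𝓝[>] 0)
        (𝓝 (c * (b - a))) := by
      have : Continuous fun t : ℝ => c * (b - a) + t * (1 / 2 * ‖z - x‖ ^ 2) := by fun_prop
      simpa using (this.tendsto 0).mono_left nhdsWithin_le_nhds
    refine ge_of_tendsto h1 ?_
    filter_upwards [Ioo_mem_nhdsGT (zero_lt_one' ℝ)] with t ht using key t ht.1 ht.2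
  rw [ha, hb, inner_smul_left]
  norm_cast
  have h2 := mul_le_mul_of_nonneg_left hlim (inv_pos.2 hc).le
  rw [← mul_assoc, inv_mul_cancel₀ hc.ne', one_mul] at h2
  simp only [conj_trivial]
  linarith

/-- Direct method: the affine minorant from `q₀` bounds the objective below, strong convexity makes
a minimizing sequence Cauchy, and lower semicontinuity passes to the limit. -/
lemma Gamma0.exists_isProxWith [CompleteSpace E] (hφ : Gamma0 φ) {x₀ q₀ : E}
    (h₀ : q₀ ∈ subdiff φ x₀) {c : ℝ} (hc : 0 < c) (u : E) :
    ∃ x, IsProxWith (fun x y : E => inner ℝ x y) φ c u x := by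
  obtain ⟨a₀, e₀, i₀⟩ := hφ.exists_coe_of_mem_subdiff h₀
  -- Minimizing over the graph of `φ` on its effective domain keeps the infimum real-valued.
  let D : Type _ := {p : E × ℝ // φ p.1 = p.2}
  let Ψ : D → ℝ := fun p => 1 / 2 * ‖p.1.1 - u‖ ^ 2 + c * p.1.2
  have : Nonempty D := ⟨⟨(x₀, a₀), e₀⟩⟩
  have hbdd : BddBelow (Set.range Ψ) := by
    refine ⟨c * (a₀ + inner ℝ q₀ (u - x₀)) - 1 / 2 * (c ^ 2 * ‖q₀‖ ^ 2), ?_⟩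
    rintro _ ⟨⟨⟨z, b⟩, hb⟩, rfl⟩
    have h1 := i₀ z
    rw [show φ z = b from hb, EReal.coe_le_coe_iff] at h1
    have h2 := mul_le_mul_of_nonneg_left h1 hc.le
    have h3 : 0 ≤ ‖z - u + c • q₀‖ ^ 2 := sq_nonneg _
    rw [norm_add_sq_real, inner_smul_right, norm_smul, mul_pow, Real.norm_of_nonneg hc.le,
      real_inner_comm] at h3
    have h4 : inner ℝ q₀ (z - x₀) = inner ℝ q₀ (z - u) + inner ℝ q₀ (u - x₀) := by
      rw [← inner_add_right]; congr 1; abel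
    rw [h4] at h2
    simp only [Ψ]
    linarith
  set μ := ⨅ p, Ψ p with hμ
  have hμle : ∀ p, μ ≤ Ψ p := fun p => ciInf_le hbdd p
  have hseq : ∀ n : ℕ, ∃ p, Ψ p < μ + 1 / ((n : ℝ) + 1) := fun n =>
    exists_lt_of_ciInf_lt (lt_add_of_pos_right _ (by positivity))
  choose s hs using hseq
  -- The midpoint of two points has objective at least `μ`, and the parallelogram law measures how
  -- much it gains by convexity.
  have hpar : ∀ p p' : D, ‖p.1.1 - p'.1.1‖ ^ 2 ≤ 4 * (Ψ p + Ψ p' - 2 * μ) := by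
    rintro ⟨⟨z, b⟩, hb⟩ ⟨⟨z', b'⟩, hb'⟩
    have h1 := hφ.convex z z' (1 / 2) (1 / 2) (by norm_num) (by norm_num) (by norm_num)
    simp only at hb hb'
    rw [hb, hb'] at h1
    norm_cast at h1
    obtain ⟨d, hd⟩ : ∃ d : ℝ, φ ((1 / 2 : ℝ) • z + (1 / 2 : ℝ) • z') = d :=
      ⟨_, (EReal.coe_toReal (fun h => by
        rw [h, top_le_iff] at h1; exact EReal.coe_ne_top _ h1) (hφ.ne_bot _)).symm⟩
    rw [hd] at h1
    norm_cast at h1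
    have h2 := hμle ⟨(_, d), hd⟩
    simp only [Ψ] at h2 ⊢
    have h3 : (1 / 2 : ℝ) • z + (1 / 2 : ℝ) • z' - u = (1 / 2 : ℝ) • ((z - u) + (z' - u)) := by
      module
    have h4 : z - z' = (z - u) - (z' - u) := by abel
    have h5 := parallelogram_law_with_norm ℝ (z - u) (z' - u)
    rw [h3, norm_smul, mul_pow, Real.norm_of_nonneg (by norm_num)] at h2
    rw [h4]
    have h6 := mul_le_mul_of_nonneg_left h1 hc.le
    nlinarith
  have hcauchy : CauchySeq fun n => (s n).1.1 := by
    rw [Metric.cauchySeq_iff']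
    intro ε hε
    obtain ⟨N, hN⟩ := exists_nat_one_div_lt (by positivity : 0 < ε ^ 2 / 8)
    refine ⟨N, fun n hn => ?_⟩
    rw [dist_eq_norm]
    refine lt_of_pow_lt_pow_left₀ 2 hε.le ?_
    have h1 := hpar (s n) (s N)
    have h2 := hs n
    have h3 := hs N
    have h4 : 1 / ((n : ℝ) + 1) ≤ 1 / ((N : ℝ) + 1) := by
      apply one_div_le_one_div_of_le (by positivity)
      have : (N : ℝ) ≤ n := by exact_mod_cast hn
      linarith
    linarith
  obtain ⟨x, hx⟩ := cauchySeq_tendsto_of_complete hcauchy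
  have hΨ : Tendsto (fun n => Ψ (s n)) atTop (𝓝 μ) := by
    refine tendsto_of_tendsto_of_tendsto_of_le_of_le tendsto_const_nhds ?_
      (fun n => hμle (s n)) (fun n => (hs n).le)
    simpa using tendsto_one_div_add_atTop_nhds_zero_nat.const_add μ
  have hφx : φ x ≤ (((μ - 1 / 2 * ‖x - u‖ ^ 2) / c : ℝ) : EReal) := by
    by_contra hlt
    rw [not_le] at hlt
    obtain ⟨r, hr1, hr2⟩ := EReal.lt_iff_exists_real_btwn.1 hlt
    have h1 := hx.eventually (hφ.lsc x r hr2)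
    have h2 : Tendsto (fun n => 1 / 2 * ‖(s n).1.1 - u‖ ^ 2 + c * r) atTop
        (𝓝 (1 / 2 * ‖x - u‖ ^ 2 + c * r)) :=
      (((hx.sub_const u).norm.pow 2).const_mul _).add_const _
    have h3 := le_of_tendsto_of_tendsto h2 hΨ (by
      filter_upwards [h1] with n hn
      rw [(s n).2, gt_iff_lt, EReal.coe_lt_coe_iff] at hn
      simp only [Ψ]
      have := mul_le_mul_of_nonneg_left hn.le hc.le
      linarith)
    rw [EReal.coe_lt_coe_iff, div_lt_iff₀ hc] at hr1
    linarith
  obtain ⟨a, ha⟩ : ∃ a : ℝ, φ x = a :=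
    ⟨_, (EReal.coe_toReal (fun h => by
      rw [h, top_le_iff] at hφx; exact EReal.coe_ne_top _ hφx) (hφ.ne_bot _)).symm⟩
  refine ⟨x, fun z => ?_⟩
  by_cases hz : φ z = ⊤
  · rw [hz, EReal.coe_mul_top_of_pos hc, EReal.coe_add_top]; exact le_top
  obtain ⟨b, hb⟩ : ∃ b : ℝ, φ z = b := ⟨_, (EReal.coe_toReal hz (hφ.ne_bot z)).symm⟩
  have h1 := hμle ⟨(z, b), hb⟩
  rw [ha, EReal.coe_le_coe_iff, le_div_iff₀ hc] at hφx
  rw [ha, hb]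
  norm_cast
  simp only [Ψ] at h1
  simp only [real_inner_self_eq_norm_sq]
  linarith

lemma Gamma0.prox_mem_subdiff [CompleteSpace E] (hφ : Gamma0 φ) {x₀ q₀ : E}
    (h₀ : q₀ ∈ subdiff φ x₀) {c : ℝ} (hc : 0 < c) (u : E) :
    c⁻¹ • (u - prox φ c u) ∈ subdiff φ (prox φ c u) :=
  hφ.mem_subdiff_of_isProxWith hc (Classical.epsilon_spec (hφ.exists_isProxWith h₀ hc u))

lemma Gamma0.hasResolvent [CompleteSpace E] (hφ : Gamma0 φ) {x₀ q₀ : E}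
    (h₀ : q₀ ∈ subdiff φ x₀) : HasResolvent fun p q => q ∈ subdiff φ p := fun s =>
  ⟨prox φ 1 s, by simpa using hφ.prox_mem_subdiff h₀ one_pos s⟩

end Subdifferential

/-! ### Fenchel conjugates and inversion of the subdifferential -/

section Conjugate

variable {E : Type*} [NormedAddCommGroup E] [InnerProductSpace ℝ E] {φ : E → EReal}

lemma coe_sub_le_conj (φ : E → EReal) (x y : E) :
    ((inner ℝ x y : ℝ) : EReal) - φ x ≤ conj φ y :=
  le_iSup (fun x : E => ((inner ℝ x y : ℝ) : EReal) - φ x) x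

lemma Gamma0.conj_eq_of_mem_subdiff (hφ : Gamma0 φ) {x q : E} (hq : q ∈ subdiff φ x) {a : ℝ}
    (ha : φ x = a) : conj φ q = ((inner ℝ x q - a : ℝ) : EReal) := by
  obtain ⟨a', ha', h⟩ := hφ.exists_coe_of_mem_subdiff hq
  obtain rfl : a = a' := by rw [ha] at ha'; exact_mod_cast ha'
  refine le_antisymm (iSup_le fun z => ?_) ?_
  · by_cases hz : φ z = ⊤
    · rw [hz, EReal.sub_top]; exact bot_le
    obtain ⟨b, hb⟩ : ∃ b : ℝ, φ z = b := ⟨_, (EReal.coe_toReal hz (hφ.ne_bot z)).symm⟩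
    have h1 := h z
    rw [hb, EReal.coe_le_coe_iff, inner_sub_right] at h1
    rw [hb]
    norm_cast
    linarith [real_inner_comm z q, real_inner_comm x q]
  · refine le_trans ?_ (coe_sub_le_conj φ x q)
    rw [ha]; norm_cast

lemma Gamma0.mem_subdiff_conj (hφ : Gamma0 φ) {x q : E} (hq : q ∈ subdiff φ x) :
    x ∈ subdiff (conj φ) q := by
  obtain ⟨a, ha, -⟩ := hφ.exists_coe_of_mem_subdiff hq
  intro z
  rw [hφ.conj_eq_of_mem_subdiff hq ha]
  refine le_trans ?_ (coe_sub_le_conj φ x z)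
  rw [ha, inner_sub_right]
  norm_cast
  linarith

lemma Gamma0.gamma0_conj (hφ : Gamma0 φ) {x₀ q₀ : E} (h₀ : q₀ ∈ subdiff φ x₀) :
    Gamma0 (conj φ) := by
  obtain ⟨a₀, e₀, -⟩ := hφ.exists_coe_of_mem_subdiff h₀
  refine ⟨fun y h => ?_, ⟨q₀, ?_⟩, ?_, ?_⟩
  · have := coe_sub_le_conj φ x₀ y
    rw [h, e₀, le_bot_iff] at this
    norm_cast at this
  · rw [hφ.conj_eq_of_mem_subdiff h₀ e₀]; exact EReal.coe_ne_top _
  · refine lowerSemicontinuous_iSup fun x => Continuous.lowerSemicontinuous ?_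
    by_cases hx : φ x = ⊤
    · simp only [hx, EReal.sub_top]; exact continuous_const
    obtain ⟨b, hb⟩ : ∃ b : ℝ, φ x = b := ⟨_, (EReal.coe_toReal hx (hφ.ne_bot x)).symm⟩
    simp only [hb, ← EReal.coe_sub]
    exact continuous_coe_real_ereal.comp (by fun_prop)
  · intro y z a b ha hb hab
    refine iSup_le fun x => ?_
    by_cases hx : φ x = ⊤
    · rw [hx, EReal.sub_top]; exact bot_le
    obtain ⟨r, hr⟩ : ∃ r : ℝ, φ x = r := ⟨_, (EReal.coe_toReal hx (hφ.ne_bot x)).symm⟩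
    have h1 := coe_sub_le_conj φ x y
    have h2 := coe_sub_le_conj φ x z
    rw [hr] at h1 h2 ⊢
    refine le_trans (le_of_eq ?_) (add_le_add
      (mul_le_mul_of_nonneg_left h1 (EReal.coe_nonneg.2 ha.le))
      (mul_le_mul_of_nonneg_left h2 (EReal.coe_nonneg.2 hb.le)))
    norm_cast
    simp only [inner_add_right, inner_smul_right]
    linear_combination r * hab

/-- Minty's argument replaces the biconjugate theorem. With `p` the prox of `x + q`, the pair `(x +
q - p, p)` lies in the graph of `∂φ^*`, and its monotonicity against `(q, x)` gives `-‖x - p‖² ≥ 0`.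
-/
lemma Gamma0.mem_subdiff_of_mem_subdiff_conj [CompleteSpace E] (hφ : Gamma0 φ) {x₀ q₀ : E}
    (h₀ : q₀ ∈ subdiff φ x₀) {x q : E} (hx : x ∈ subdiff (conj φ) q) : q ∈ subdiff φ x := by
  have h1 := hφ.prox_mem_subdiff h₀ one_pos (x + q)
  set p := prox φ 1 (x + q)
  rw [inv_one, one_smul] at h1
  have h2 := (hφ.gamma0_conj h₀).isThreeCyclic.isMonotoneRel hx (hφ.mem_subdiff_conj h1)
  have h3 : q - (x + q - p) = -(x - p) := by abel
  rw [h3, inner_neg_left, real_inner_self_eq_norm_sq] at h2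
  have h4 : x - p = 0 := norm_eq_zero.1 (by nlinarith [norm_nonneg (x - p)])
  have h5 : x = p := sub_eq_zero.1 h4
  rw [← h5] at h1
  simpa using h1

end Conjugate
lemma ereal_coe_finset_sum {ι : Type*} (s : Finset ι) (a : ι → ℝ) :
    ((∑ i ∈ s, a i : ℝ) : EReal) = ∑ i ∈ s, (a i : EReal) :=
  map_sum (⟨⟨Real.toEReal, EReal.coe_zero⟩, EReal.coe_add⟩ : ℝ →+ EReal) a s

lemma tendsto_toWeakSpace {H : Type*} [NormedAddCommGroup H] [InnerProductSpace ℝ H]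
    [CompleteSpace H] {ι : Type*} {x : ι → H} {l : Filter ι} {a : H} (hx : WeakTendsto x l a) :
    Tendsto (fun k => toWeakSpace ℝ H (x k)) l (𝓝 (toWeakSpace ℝ H a)) := by
  have h : ∀ b : StrongDual ℝ H, Tendsto (fun k => b (x k)) l (𝓝 (b a)) := by
    intro b
    have h1 : ∀ z, inner ℝ z ((InnerProductSpace.toDual ℝ H).symm b) = b z := fun z => by
      rw [real_inner_comm, InnerProductSpace.toDual_symm_apply]
    simpa only [h1] using hx ((InnerProductSpace.toDual ℝ H).symm b)
  have hind : IsInducing fun (p : WeakSpace ℝ H) (b : StrongDual ℝ H) =>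
      (topDualPairing ℝ H).flip p b := ⟨rfl⟩
  exact hind.tendsto_nhds_iff.2 (tendsto_pi_nhds.2 h)

/-! ### The weighted product space and its `ℓ²` model -/

section Product

variable {H : Type*} [NormedAddCommGroup H] [InnerProductSpace ℝ H] [CompleteSpace H]
  {m : ℕ} {G : Fin m → Type*} [∀ i, NormedAddCommGroup (G i)] [∀ i, InnerProductSpace ℝ (G i)]
  {h : ∀ i, G i → EReal} {w : Fin m → ℝ}

/-- The proximity operator of the conjugate of a separable function, both with respect to the
weighted inner product, is characterized componentwise. -/
lemma proxWith_weightedInner_eq (hh : ∀ i, Gamma0 (h i)) (hw : ∀ i, 0 < w i) {c : ℝ} (hc : 0 < c)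
    {U Y : ∀ i, G i} (hY : ∀ i, w i • Y i ∈ subdiff (h i) (c⁻¹ • (U i - Y i))) :
    proxWith (weightedInner w) (conjWith (weightedInner w) fun q : ∀ i, G i => ∑ i, h i (q i))
      c U = Y := by
  choose a ha hle using fun i => (hh i).exists_coe_of_mem_subdiff (hY i)
  set s : ∀ i, G i := fun i => c⁻¹ • (U i - Y i) with hs
  have hsum : ∑ i, h i (s i) = ((∑ i, a i : ℝ) : EReal) := by
    rw [ereal_coe_finset_sum]; exact Finset.sum_congr rfl fun i _ => ha i
  -- The point `s` gives an affine minorant of the weighted conjugate, which `hval` shows to be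
  -- exact at `Y`. The conjugate need not be computed elsewhere.
  have hlow : ∀ z, ((weightedInner w s z - ∑ i, a i : ℝ) : EReal) ≤
      conjWith (weightedInner w) (fun q : ∀ i, G i => ∑ i, h i (q i)) z := by
    intro z
    have h1 := le_iSup (fun q : ∀ i, G i =>
      ((weightedInner w q z : ℝ) : EReal) - ∑ i, h i (q i)) s
    rw [hsum, ← EReal.coe_sub] at h1
    exact h1
  have hval : conjWith (weightedInner w) (fun q : ∀ i, G i => ∑ i, h i (q i)) Y =
      ((weightedInner w s Y - ∑ i, a i : ℝ) : EReal) := by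
    refine le_antisymm (iSup_le fun q => ?_) (hlow Y)
    have h1 : ((∑ i, (a i + inner ℝ (w i • Y i) (q i - s i)) : ℝ) : EReal) ≤ ∑ i, h i (q i) := by
      rw [ereal_coe_finset_sum]
      exact Finset.sum_le_sum fun i _ => hle i (q i)
    refine (EReal.sub_le_sub le_rfl h1).trans ?_
    rw [← EReal.coe_sub, EReal.coe_le_coe_iff]
    refine le_of_eq ?_
    simp only [weightedInner, ← Finset.sum_sub_distrib]
    refine Finset.sum_congr rfl fun i _ => ?_
    rw [inner_sub_right, inner_smul_left, inner_smul_left, conj_trivial,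
      real_inner_comm (Y i) (q i), real_inner_comm (Y i) (s i)]
    ring
  refine proxWith_eq (fun d => ?_) (fun d hd => ?_) hval fun z => ?_
  · exact Finset.sum_nonneg fun i _ => mul_nonneg (hw i).le real_inner_self_nonneg
  · have h1 := (Finset.sum_eq_zero_iff_of_nonneg fun i _ =>
      mul_nonneg (hw i).le real_inner_self_nonneg).1 hd
    funext i
    have h2 := h1 i (Finset.mem_univ i)
    exact inner_self_eq_zero.1 ((mul_eq_zero.1 h2).resolve_left (hw i).ne')
  · refine le_trans ?_ (add_le_add le_rfl
      (mul_le_mul_of_nonneg_left (hlow z) (EReal.coe_nonneg.2 hc.le)))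
    norm_cast
    refine le_of_eq ?_
    -- An exact identity because `c • s = U - Y`. It is the quadratic growth that `proxWith_eq`
    -- requires.
    have key : 1 / 2 * weightedInner w (Y - U) (Y - U) + c * weightedInner w s Y
        + 1 / 2 * weightedInner w (z - Y) (z - Y) =
        1 / 2 * weightedInner w (z - U) (z - U) + c * weightedInner w s z := by
      simp only [weightedInner, Finset.mul_sum, ← Finset.sum_add_distrib]
      refine Finset.sum_congr rfl fun i _ => ?_
      have h1 : z i - U i = (z i - Y i) - (U i - Y i) := by abel
      have h2 : ∀ b : G i, c * inner ℝ (s i) b = inner ℝ (U i - Y i) b := fun b => by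
        rw [hs, inner_smul_left, conj_trivial, ← mul_assoc, mul_inv_cancel₀ hc.ne', one_mul]
      have h3 : ∀ b : G i, c * (w i * inner ℝ (s i) b) = w i * inner ℝ (U i - Y i) b :=
        fun b => by rw [← h2]; ring
      rw [h3, h3]
      simp only [Pi.sub_apply]
      rw [h1, ← neg_sub (U i) (Y i), inner_neg_neg, real_inner_self_eq_norm_sq,
        real_inner_self_eq_norm_sq, real_inner_self_eq_norm_sq, norm_sub_sq_real (z i - Y i),
        real_inner_comm (U i - Y i) (z i - Y i), inner_sub_right]
      ring
    linarith

variable [∀ i, CompleteSpace (G i)]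

open ContinuousLinearMap

/-- The operator `x ↦ (√wᵢ Bᵢ x)ᵢ` into the `ℓ²`-product; up to the isometry `yᵢ ↦ √wᵢ yᵢ` it is
`x ↦ (Bᵢ x)ᵢ` into the product with the weighted inner product. -/
noncomputable def scaledProd (B : ∀ i, H →L[ℝ] G i) (w : Fin m → ℝ) : H →L[ℝ] PiLp 2 G :=
  ((PiLp.continuousLinearEquiv 2 ℝ G).symm : (∀ i, G i) →L[ℝ] PiLp 2 G) ∘L
    ContinuousLinearMap.pi fun i => √(w i) • B i

omit [CompleteSpace H] [∀ i, CompleteSpace (G i)] in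
lemma scaledProd_apply (B : ∀ i, H →L[ℝ] G i) (w : Fin m → ℝ) (x : H) (i : Fin m) :
    scaledProd B w x i = √(w i) • B i x := rfl

lemma adjoint_scaledProd (B : ∀ i, H →L[ℝ] G i) (w : Fin m → ℝ) (y : PiLp 2 G) :
    adjoint (scaledProd B w) y = ∑ i, √(w i) • adjoint (B i) (y i) := by
  refine ext_inner_left ℝ fun z => ?_
  rw [adjoint_inner_right, PiLp.inner_apply, inner_sum]
  refine Finset.sum_congr rfl fun i _ => ?_
  rw [scaledProd_apply, inner_smul_left, inner_smul_right, adjoint_inner_right, conj_trivial]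

/-- An operator and its adjoint have equal norms, so componentwise bounds on `scaledProd` suffice.
Multiplied by `lam`, the constant is the `θ < 1` of the abstract scheme. -/
lemma norm_adjoint_scaledProd_sq_le (B : ∀ i, H →L[ℝ] G i) (hw : ∀ i, 0 < w i) (y : PiLp 2 G) :
    ‖adjoint (scaledProd B w) y‖ ^ 2 ≤ (∑ i, w i * ‖B i‖ ^ 2) * ‖y‖ ^ 2 := by
  have hS : 0 ≤ ∑ i, w i * ‖B i‖ ^ 2 :=
    Finset.sum_nonneg fun i _ => mul_nonneg (hw i).le (sq_nonneg _)
  have h1 : ‖scaledProd B w‖ ≤ √(∑ i, w i * ‖B i‖ ^ 2) := by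
    refine opNorm_le_bound _ (Real.sqrt_nonneg _) fun x => ?_
    refine abs_le_of_sq_le_sq' ?_ (by positivity) |>.2
    rw [mul_pow, Real.sq_sqrt hS, PiLp.norm_sq_eq_of_L2, Finset.sum_mul]
    refine Finset.sum_le_sum fun i _ => ?_
    rw [scaledProd_apply, norm_smul, mul_pow, Real.norm_of_nonneg (Real.sqrt_nonneg _),
      Real.sq_sqrt (hw i).le, mul_assoc, ← mul_pow]
    gcongr
    · exact (hw i).le
    · exact (B i).le_opNorm x
  have h2 : ‖adjoint (scaledProd B w) y‖ ≤ √(∑ i, w i * ‖B i‖ ^ 2) * ‖y‖ := by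
    refine ((adjoint (scaledProd B w)).le_opNorm y).trans ?_
    rw [LinearIsometryEquiv.norm_map]
    gcongr
  calc _ ≤ (√(∑ i, w i * ‖B i‖ ^ 2) * ‖y‖) ^ 2 := by gcongr
    _ = _ := by rw [mul_pow, Real.sq_sqrt hS]

/-- The subdifferential of the conjugate of `(qᵢ) ↦ ∑ hᵢ(qᵢ)` with respect to the weighted inner
product, transported to the `ℓ²`-product by the isometry `yᵢ ↦ √wᵢ yᵢ`. -/
def scaledConjSubdiff (h : ∀ i, G i → EReal) (w : Fin m → ℝ) (y η : PiLp 2 G) : Prop :=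
  ∀ i, (√(w i))⁻¹ • η i ∈ subdiff (conj (h i)) (√(w i) • y i)

omit [∀ i, CompleteSpace (G i)] in
lemma isMonotoneRel_scaledConjSubdiff (hw : ∀ i, 0 < w i) (hc : ∀ i, Gamma0 (conj (h i))) :
    IsMonotoneRel (scaledConjSubdiff h w) := by
  intro p q p' q' hpq hpq'
  rw [PiLp.inner_apply]
  refine Finset.sum_nonneg fun i _ => ?_
  have h1 := (hc i).isThreeCyclic.isMonotoneRel (hpq i) (hpq' i)
  rw [← smul_sub, ← smul_sub, inner_smul_left, inner_smul_right, conj_trivial, ← mul_assoc,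
    mul_inv_cancel₀ (Real.sqrt_pos.2 (hw i)).ne', one_mul] at h1
  exact h1

lemma hasResolvent_scaledConjSubdiff (hw : ∀ i, 0 < w i) (hc : ∀ i, Gamma0 (conj (h i)))
    {q₀ x₀ : ∀ i, G i} (h₀ : ∀ i, x₀ i ∈ subdiff (conj (h i)) (q₀ i)) :
    HasResolvent (scaledConjSubdiff h w) := by
  intro s
  -- With `t = √w_i p_i`, the inclusion `(√w_i)⁻¹(s_i - p_i) ∈ ∂h_i^*(t)` becomes `w_i⁻¹(√w_i s_i -
  -- t) ∈ ∂h_i^*(t)`, so `t` is a prox with parameter `w_i`.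
  refine ⟨WithLp.toLp 2 fun i => (√(w i))⁻¹ • prox (conj (h i)) (w i) (√(w i) • s i),
    fun i => ?_⟩
  have h1 := (hc i).prox_mem_subdiff (h₀ i) (hw i) (√(w i) • s i)
  have hpos := (Real.sqrt_pos.2 (hw i)).ne'
  have h2 : (w i)⁻¹ * √(w i) = (√(w i))⁻¹ := by
    nth_rewrite 1 [← Real.mul_self_sqrt (hw i).le]
    field_simp
  have h3 : (√(w i))⁻¹ * (√(w i))⁻¹ = (w i)⁻¹ := by
    rw [← mul_inv, Real.mul_self_sqrt (hw i).le]
  simp only [PiLp.sub_apply]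
  rw [smul_smul, mul_inv_cancel₀ hpos, one_smul, smul_sub, smul_smul, h3]
  rwa [smul_sub, smul_smul, h2] at h1

variable {f : H → ℝ} {g : H → EReal} {B : ∀ i, H →L[ℝ] G i}

lemma objective_le_of_mem_subdiff (hfc : ConvexOn ℝ Set.univ f) (hfd : Differentiable ℝ f)
    (hg : Gamma0 g) (hh : ∀ i, Gamma0 (h i)) {xs : H} {ys : ∀ i, G i}
    (hgs : -gradient f xs - ∑ i, adjoint (B i) (ys i) ∈ subdiff g xs)
    (hhs : ∀ i, ys i ∈ subdiff (h i) (B i xs)) (z : H) :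
    objective f g h B xs ≤ objective f g h B z := by
  obtain ⟨a, ha, hag⟩ := hg.exists_coe_of_mem_subdiff hgs
  choose b hb hbh using fun i => (hh i).exists_coe_of_mem_subdiff (hhs i)
  have h1 : ((∑ i, (b i + inner ℝ (ys i) (B i z - B i xs)) : ℝ) : EReal) ≤ ∑ i, h i (B i z) := by
    rw [ereal_coe_finset_sum]
    exact Finset.sum_le_sum fun i _ => hbh i (B i z)
  have h2 : ((f xs + inner ℝ (gradient f xs) (z - xs) : ℝ) : EReal) ≤ f z :=
    EReal.coe_le_coe_iff.2 (add_inner_gradient_le_of_convexOn hfc hfd xs z)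
  refine le_trans ?_ (add_le_add (add_le_add h2 (hag z)) h1)
  simp only [objective, ha, hb]
  rw [← ereal_coe_finset_sum]
  norm_cast
  refine le_of_eq ?_
  have h3 : ∀ i, inner ℝ (ys i) (B i z - B i xs) = inner ℝ (adjoint (B i) (ys i)) (z - xs) :=
    fun i => by rw [adjoint_inner_left, map_sub]
  simp only [h3]
  rw [Finset.sum_add_distrib, inner_sub_left, inner_neg_left, sum_inner]
  ring

end Product

end CompositeSplitting

/-! ### Identification with PDFP and convergence of the algorithm -/

open CompositeSplitting in
theorem theorem4p2 {H : Type*} [NormedAddCommGroup H] [InnerProductSpace ℝ H] [CompleteSpace H]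
    {m : ℕ} {G : Fin m → Type*} [∀ i, NormedAddCommGroup (G i)]
    [∀ i, InnerProductSpace ℝ (G i)] [∀ i, CompleteSpace (G i)]
    (f : H → ℝ) (g : H → EReal) (h : ∀ i, G i → EReal) (B : ∀ i, H →L[ℝ] G i)
    (L : ℝ≥0) (hL : 0 < L)
    (hf_convex : ConvexOn ℝ Set.univ f) (hf_diff : Differentiable ℝ f)
    (hf_lip : LipschitzWith L (gradient f))
    (hg : Gamma0 g) (hh : ∀ i, Gamma0 (h i))
    -- the optimality system `0 ∈ ∇f(x) + ∂g(x) + ∑ i, B_i^* ∂h_i(B_i x)` has a solution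
    (hsol : ∃ (xs : H) (ys : ∀ i, G i),
      -(gradient f xs) - ∑ i, ContinuousLinearMap.adjoint (B i) (ys i) ∈ subdiff g xs ∧
      ∀ i, ys i ∈ subdiff (h i) (B i xs))
    (w : Fin m → ℝ) (hw_pos : ∀ i, 0 < w i) (hw_sum : ∑ i, w i = 1)
    (γ lam : ℝ) (hγ_pos : 0 < γ) (hγ_lt : γ < 2 / (L : ℝ))
    (hlam_pos : 0 < lam) (hlam_lt : lam * ∑ i, w i * ‖B i‖ ^ 2 < 1)
    (u x : ℕ → H) (y : ℕ → ∀ i, G i)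
    (halg : IsDualFBSequence f g h B w γ lam (fun _ => 1) u x y) :
    -- `(x, y)` is a PDFP sequence on the product space with the weighted inner product
    (∃ Bstar : (∀ i, G i) → H,
      (∀ (z : H) (q : ∀ i, G i),
        weightedInner w (fun i => B i z) q = inner ℝ z (Bstar q)) ∧
      IsPDFPSequence (weightedInner w) f g (fun q : ∀ i, G i => ∑ i, h i (q i))
        (fun z i => B i z) Bstar γ lam x y) ∧
    -- `x` converges weakly to a minimizer of the objective function
    ∃ xs : H, (∀ z : H, objective f g h B xs ≤ objective f g h B z) ∧
      Tendsto (fun k => toWeakSpace ℝ H (x k)) atTop (𝓝 (toWeakSpace ℝ H xs)) := by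
  have hL' : (0 : ℝ) < L := hL
  obtain ⟨xs, ys, hgs, hhs⟩ := hsol
  have hc : ∀ i, Gamma0 (conj (h i)) := fun i => (hh i).gamma0_conj (hhs i)
  have hcs : ∀ i, B i xs ∈ subdiff (conj (h i)) (ys i) := fun i => (hh i).mem_subdiff_conj (hhs i)
  have hsq : ∀ i, 0 < √(w i) := fun i => Real.sqrt_pos.2 (hw_pos i)
  have hss : ∀ i, √(w i) * √(w i) = w i := fun i => Real.mul_self_sqrt (hw_pos i).le
  set Bstar : (∀ i, G i) → H := fun q => ∑ j, w j • ContinuousLinearMap.adjoint (B j) (q j)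
    with hBstar
  set v : ℕ → H := fun k => prox g γ (u k - γ • Bstar (y k)) with hv
  -- The prox returns `w_i y_i^{k+1}`. In its optimality condition the weight in the parameter
  -- cancels the weight in the argument. Both the PDFP identity and the abstract orbit follow from
  -- this inclusion.
  have hdual : ∀ k i, B i (v k) + (γ / lam) • (y k i - y (k + 1) i) ∈
      subdiff (conj (h i)) (w i • y (k + 1) i) := by
    intro k i
    have hwc : 0 < w i * (lam / γ) := mul_pos (hw_pos i) (by positivity)
    have h1 := (hc i).prox_mem_subdiff (hcs i) hwc (w i • (y k i + (lam / γ) • B i (v k)))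
    have h2 : y (k + 1) i = (1 / w i) • prox (conj (h i)) (w i * (lam / γ))
        (w i • (y k i + (lam / γ) • B i (v k))) := by
      rw [halg.inner_loop k]; rfl
    have h3 : prox (conj (h i)) (w i * (lam / γ)) (w i • (y k i + (lam / γ) • B i (v k))) =
        w i • y (k + 1) i := by
      rw [h2, smul_smul, mul_one_div_cancel (hw_pos i).ne', one_smul]
    rw [h3, ← smul_sub, smul_smul, mul_inv, mul_assoc, mul_comm (lam / γ)⁻¹, ← mul_assoc,
      inv_mul_cancel₀ (hw_pos i).ne', one_mul, inv_div] at h1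
    have h4 : (γ / lam) • (y k i + (lam / γ) • B i (v k) - y (k + 1) i) =
        B i (v k) + (γ / lam) • (y k i - y (k + 1) i) := by
      have : γ / lam * (lam / γ) = 1 := by field_simp
      rw [smul_sub, smul_add, smul_smul, this, one_smul, smul_sub]; abel
    rwa [h4] at h1
  have hu : ∀ k, u k = x k - γ • gradient f (x k) := halg.outer
  have hx : ∀ k, x (k + 1) = prox g γ (u k - γ • Bstar (y (k + 1))) := halg.update
  refine ⟨⟨Bstar, fun z q => ?_, v, fun k => ⟨?_, ?_, ?_⟩⟩, ?_⟩
  · simp only [weightedInner, hBstar, inner_sum, inner_smul_right,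
      ContinuousLinearMap.adjoint_inner_right]
  · rw [← hu]
  · refine (proxWith_weightedInner_eq hh hw_pos (by positivity) fun i => ?_).symm
    refine (hh i).mem_subdiff_of_mem_subdiff_conj (hhs i) ?_
    have h1 : (lam / γ)⁻¹ • ((y k + (lam / γ) • fun i => B i (v k)) i - y (k + 1) i) =
        B i (v k) + (γ / lam) • (y k i - y (k + 1) i) := by
      have : γ / lam * (lam / γ) = 1 := by field_simp
      simp only [Pi.add_apply, Pi.smul_apply]
      rw [inv_div, smul_sub, smul_add, smul_smul, this, one_smul, smul_sub]; abel
    rw [h1]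
    exact hdual k i
  · rw [hx k, hu]
  have hadj : ∀ q : ∀ i, G i, ContinuousLinearMap.adjoint (scaledProd B w)
      (WithLp.toLp 2 fun i => √(w i) • q i) = Bstar q := by
    intro q
    rw [adjoint_scaledProd]
    refine Finset.sum_congr rfl fun i _ => ?_
    rw [map_smul, smul_smul, hss]
  have horbit : IsPDFPOrbit (fun p q => q ∈ subdiff g p) (scaledConjSubdiff h w) (gradient f)
      (scaledProd B w) γ lam x v fun k => WithLp.toLp 2 fun i => √(w i) • y k i := by
    refine ⟨fun k => ?_, fun k i => ?_, fun k => ?_⟩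
    · have h1 := hg.prox_mem_subdiff hgs hγ_pos (u k - γ • Bstar (y k))
      rw [hadj, ← hu]
      exact h1
    · have h1 := hdual k i
      have h2 : (√(w i))⁻¹ • (√(w i) • B i (v k)
          + (γ / lam) • (√(w i) • y k i - √(w i) • y (k + 1) i)) =
          B i (v k) + (γ / lam) • (y k i - y (k + 1) i) := by
        rw [← smul_sub, smul_comm (γ / lam), ← smul_add, smul_smul,
          inv_mul_cancel₀ (hsq i).ne', one_smul]
      simp only [PiLp.add_apply, PiLp.smul_apply, PiLp.sub_apply, scaledProd_apply]
      rw [h2, smul_smul, hss]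
      exact h1
    · have h1 := hg.prox_mem_subdiff hgs hγ_pos (u k - γ • Bstar (y (k + 1)))
      rw [← hx] at h1
      rw [hadj, ← hu]
      exact h1
  -- The optimality system uses the unweighted `∑ B_i^* ys_i`, so the weighted dual solution is
  -- `ys_i / w_i`. Its image under `√w_i` scaling is `ys_i / √w_i`.
  have hsol : IsPrimalDualZero (fun p q => q ∈ subdiff g p) (scaledConjSubdiff h w) (gradient f)
      (scaledProd B w) xs (WithLp.toLp 2 fun i => (√(w i))⁻¹ • ys i) := by
    refine ⟨?_, fun i => ?_⟩
    · simpa only [adjoint_scaledProd, map_smul, smul_smul, mul_inv_cancel₀ (hsq _).ne',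
        one_smul] using hgs
    · simpa only [scaledProd_apply, smul_smul, mul_inv_cancel₀ (hsq _).ne',
        inv_mul_cancel₀ (hsq _).ne', one_smul] using hcs i
  obtain ⟨x₀, y₀, ⟨h1, h2⟩, h3⟩ := horbit.exists_weak_limit hg.isThreeCyclic
    (isMonotoneRel_scaledConjSubdiff hw_pos hc) (hg.hasResolvent hgs)
    (hasResolvent_scaledConjSubdiff hw_pos hc hcs)
    (inner_gradient_sub_ge hf_convex hf_diff hL hf_lip) hγ_pos
    (hγ_lt.trans_eq (by ring)) hlam_pos hlam_lt
    (fun q => (mul_le_mul_of_nonneg_left (norm_adjoint_scaledProd_sq_le B hw_pos q)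
      hlam_pos.le).trans_eq (mul_assoc _ _ _).symm) ⟨_, _, hsol⟩
  refine ⟨x₀, objective_le_of_mem_subdiff (ys := fun i => √(w i) • y₀ i) hf_convex hf_diff hg hh
    ?_ fun i => ?_, tendsto_toWeakSpace h3⟩
  · simpa only [adjoint_scaledProd, map_smul] using h1
  · refine (hh i).mem_subdiff_of_mem_subdiff_conj (hhs i) ?_
    simpa only [scaledProd_apply, smul_smul, inv_mul_cancel₀ (hsq _).ne', one_smul] using h2 i
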